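/- Let $(R,\mathfrak m,k)$ be a commutative Noetherian local ring of Krull dimension $d$ which is Cohen-Macaulay, i.e. $\operatorname{depth} R = \dim R = d$. Let $M$ be a finitely generated $R$-module (not necessarily maximal Cohen-Macaulay), and let $$\cdots \to F_2 \xrightarrow{\partial_2} F_1 \xrightarrow{\partial_1} F_0 \xrightarrow{\partial_0} M \to 0$$ be an augmented minimal free resolution of $M$, i.e. an exact sequence in which every $F_i$ is a finitely generated free $R$-module and $\partial_{i}(F_{i})\subseteq \mathfrak m F_{i-1}$ for all $i\ge 1$. For $n\ge 0$ let $\Omega_n^R(M)$, the $n$-th syzygy module of $M$, be the image of $\partial_n$ (it is independent of the resolution up to isomorphism). Then for every $n \ge d+1$ no non-zero direct summand $L$ of $\Omega_n^R(M)$ is of any of the following types: 1. $L$ is a semidualizing $R$-module, that is, a finitely generated $R$-module such that the natural homomorphism $R\to \operatorname{Hom}_R(L,L)$ is an isomorphism and $\operatorname{Ext}_R^i(L,L)=0$ for all $i\ge 1$; 2. $L$ is a free $R$-module; 3. $L$ has finite injective dimension over $R$. -/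

import Mathlib

universe u

/-- The depth of a local ring: the supremum of the lengths of the regular sequences contained in
its maximal ideal. -/
noncomputable def localDepth (R : Type u) [CommRing R] [IsLocalRing R] : ℕ∞ :=
  ⨆ (rs : List R) (_ : (∀ r ∈ rs, r ∈ IsLocalRing.maximalIdeal R) ∧
    RingTheory.Sequence.IsRegular R rs), (rs.length : ℕ∞)

/-- A (commutative) local ring is Cohen-Macaulay if it is Noetherian and its depth equals its
Krull dimension. -/
structure IsCohenMacaulayLocalRing (R : Type u) [CommRing R] [IsLocalRing R] : Prop where
  noetherian : IsNoetherianRing R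
  depth_eq_dim : (localDepth R : WithBot ℕ∞) = ringKrullDim R

/-- A minimal free resolution `⋯ → F 2 → F 1 → F 0 → M → 0` of a module `M` over a local ring:
an exact complex of finitely generated free modules, with augmentation `ε : F 0 → M`, such that
the image of each differential `d n : F (n + 1) → F n` lies in `𝔪 • F n`. -/
structure MinimalFreeResolution (R : Type u) [CommRing R] [IsLocalRing R]
    (M : Type u) [AddCommGroup M] [Module R M] where
  F : ℕ → ModuleCat.{u} R
  finite : ∀ n, Module.Finite R (F n)
  free : ∀ n, Module.Free R (F n)
  d : ∀ n, F (n + 1) →ₗ[R] F n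
  ε : F 0 →ₗ[R] M
  ε_surjective : Function.Surjective ε
  exact_zero : Function.Exact (d 0) ε
  exact_succ : ∀ n, Function.Exact (d (n + 1)) (d n)
  minimal : ∀ n, LinearMap.range (d n) ≤
    IsLocalRing.maximalIdeal R • (⊤ : Submodule R (F n))

namespace MinimalFreeResolution

variable {R : Type u} [CommRing R] [IsLocalRing R] {M : Type u} [AddCommGroup M] [Module R M]

/-- The target of the `n`-th differential of the augmented resolution: `M` for `n = 0`, and
`F (n - 1)` for `n ≥ 1`. -/
def augTarget (P : MinimalFreeResolution R M) : ℕ → ModuleCat.{u} R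
  | 0 => ModuleCat.of R M
  | n + 1 => P.F n

/-- The `n`-th differential of the augmented resolution: the augmentation for `n = 0`, and
`F n → F (n - 1)` for `n ≥ 1`. -/
def augDiff (P : MinimalFreeResolution R M) : ∀ n, P.F n →ₗ[R] P.augTarget n
  | 0 => P.ε
  | n + 1 => P.d n

/-- The `n`-th syzygy module: the image of the `n`-th differential of the augmented resolution. -/
def syzygy (P : MinimalFreeResolution R M) (n : ℕ) : Submodule R (P.augTarget n) :=
  LinearMap.range (P.augDiff n)

end MinimalFreeResolution

/-- A finitely generated module `L` is semidualizing if the homothety map `R → End_R(L)` is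
bijective and `Ext^i_R(L, L) = 0` for all `i ≥ 1`. -/
structure IsSemidualizing (R : Type u) [CommRing R] (L : Type u) [AddCommGroup L] [Module R L] :
    Prop where
  finite : Module.Finite R L
  bijective : Function.Bijective (algebraMap R (Module.End R L))
  ext_eq_zero : ∀ i : ℕ, 1 ≤ i →
    Subsingleton (CategoryTheory.Abelian.Ext (ModuleCat.of R L) (ModuleCat.of R L) i)

/-!
Take a maximal `R`-regular sequence `rs` and an element `s ∉ (rs)` with `𝔪 s ⊆ (rs)`. When
`rs.length < n`, the sequence is weakly regular on all relevant syzygies, so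
`Tor₁(R ⧸ (rs), Ω_{n-1}) = 0` and `Ω_n ⧸ (rs) Ω_n` embeds in `F_{n-1} ⧸ (rs) F_{n-1}`. As
`Ω_n ⊆ 𝔪 F_{n-1}`, the element `s` kills `Ω_n ⧸ (rs) Ω_n`, hence also `L ⧸ (rs) L` for every direct
summand `L` of `Ω_n`.

For each of the three types of `L` this forces `s ∈ (rs)`. For `L` semidualizing,
`R ⧸ (rs) = Hom(L, L) ⧸ (rs) Hom(L, L)` embeds in `Hom(L, L ⧸ (rs) L)`. For `L` of finite injective
dimension, `s` kills `Ext^i(R ⧸ (rs), L)` for `i = rs.length`, and this is enough to run a downward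
induction on `i` showing `Ext^i(k, L) = 0` for all `i`.
-/

open CategoryTheory Abelian IsLocalRing RingTheory.Sequence

section WeaklyRegular

open scoped Pointwise

variable {R M N : Type*} [CommRing R] [AddCommGroup M] [Module R M] [AddCommGroup N] [Module R N]
  {rs : List R}

lemma isWeaklyRegular_of_comap_smul_top_le (hM : IsWeaklyRegular M rs) (f : N →ₗ[R] M)
    (hf : ∀ k < rs.length, (Ideal.ofList (rs.take k) • ⊤ : Submodule R M).comap f ≤
      Ideal.ofList (rs.take k) • ⊤) :
    IsWeaklyRegular N rs := by
  simp only [isWeaklyRegular_iff, isSMulRegular_quotient_iff_mem_of_smul_mem] at hM ⊢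
  intro k hk v hv
  refine hf k hk (hM k hk (f v) ?_)
  rw [← map_smul]
  exact Submodule.smul_top_le_comap_smul_top _ f hv

lemma isWeaklyRegular_of_leftInverse (hM : IsWeaklyRegular M rs) {i : N →ₗ[R] M} {p : M →ₗ[R] N}
    (hpi : Function.LeftInverse p i) : IsWeaklyRegular N rs :=
  isWeaklyRegular_of_comap_smul_top_le hM i fun _ _ v hv ↦
    hpi v ▸ Submodule.smul_top_le_comap_smul_top _ p hv

lemma isWeaklyRegular_of_flat [Module.Flat R M] (hR : IsWeaklyRegular R rs) :
    IsWeaklyRegular M rs :=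
  ((TensorProduct.rid R M).isWeaklyRegular_congr rs).mp (hR.isWeaklyRegular_lTensor (M₂ := M))

/-- This is the vanishing of `Tor₁(R ⧸ (rs), Q)`. -/
lemma comap_smul_top_le_of_exact {Q : Type*} [AddCommGroup Q] [Module R Q] {f : N →ₗ[R] M}
    {g : M →ₗ[R] Q} (hf : Function.Injective f) (hfg : Function.Exact f g)
    (hg : Function.Surjective g) (hQ : IsWeaklyRegular Q rs) :
    (Ideal.ofList rs • ⊤ : Submodule R M).comap f ≤ Ideal.ofList rs • ⊤ := by
  intro v hv
  have hexact := map_first_exact_on_four_term_right_exact_of_isSMulRegular_last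
    ((f.exact_zero_iff_injective PUnit).mpr hf) hfg hg hQ
  obtain ⟨u, hu⟩ := (hexact (Submodule.Quotient.mk v)).mp ((Submodule.Quotient.mk_eq_zero _).mpr hv)
  obtain ⟨u, rfl⟩ := Submodule.Quotient.mk_surjective _ u
  exact (Submodule.Quotient.mk_eq_zero _).mp (hu.symm.trans (by simp))

lemma mem_of_forall_smul_mem_smul_top_of_free [Module.Free R M] [Nontrivial M] {I : Ideal R} {s : R}
    (h : ∀ v : M, s • v ∈ (I • ⊤ : Submodule R M)) : s ∈ I := by
  let b := Module.Free.chooseBasis R M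
  obtain ⟨j⟩ := b.index_nonempty
  simpa using Submodule.smul_top_le_comap_smul_top I (b.coord j) (h (b j))

lemma mkQ_mem_ofList_smul_top {y : R} {x : M}
    (hx : x ∈ (Ideal.ofList (y :: rs) • ⊤ : Submodule R M)) :
    (y • (⊤ : Submodule R M)).mkQ x ∈ (Ideal.ofList rs • ⊤ : Submodule R (QuotSMulTop y M)) := by
  rw [Ideal.ofList_cons_smul] at hx
  obtain ⟨a, ha, b, hb, rfl⟩ := Submodule.mem_sup.mp hx
  rw [map_add, Submodule.mkQ_apply, (Submodule.Quotient.mk_eq_zero _).mpr ha, zero_add]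
  exact Submodule.smul_top_le_comap_smul_top _ (Submodule.mkQ _) hb

end WeaklyRegular

namespace MinimalFreeResolution

variable {R : Type u} [CommRing R] [IsLocalRing R] {M : Type u} [AddCommGroup M] [Module R M]
  (P : MinimalFreeResolution R M) {rs : List R} {n : ℕ}

lemma exact_augDiff (n : ℕ) : Function.Exact (P.d n) (P.augDiff n) := by
  cases n with
  | zero => exact P.exact_zero
  | succ n => exact P.exact_succ n

lemma comap_subtype_syzygy_smul_top_le (hrs : IsWeaklyRegular (P.syzygy n) rs) :
    (Ideal.ofList rs • ⊤ : Submodule R (P.augTarget (n + 1))).comap (P.syzygy (n + 1)).subtype ≤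
      Ideal.ofList rs • ⊤ := by
  have hexact : Function.Exact (P.syzygy (n + 1)).subtype (P.augDiff n).rangeRestrict := fun x ↦
    Subtype.ext_iff.trans <| (P.exact_augDiff n x).trans (Subtype.range_coe ▸ Iff.rfl)
  exact comap_smul_top_le_of_exact (P.syzygy (n + 1)).injective_subtype hexact
    (P.augDiff n).surjective_rangeRestrict hrs

lemma isWeaklyRegular_syzygy (hrs : IsWeaklyRegular R rs) (hn : rs.length ≤ n) :
    IsWeaklyRegular (P.syzygy n) rs := by
  induction n generalizing rs with
  | zero => simp [List.length_eq_zero_iff.mp (Nat.le_zero.mp hn)]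
  | succ n ih =>
    have := P.free n
    refine isWeaklyRegular_of_comap_smul_top_le (isWeaklyRegular_of_flat (M := P.F n) hrs)
      (P.syzygy (n + 1)).subtype fun k hk ↦ P.comap_subtype_syzygy_smul_top_le (ih ?_ ?_)
    · exact ((isWeaklyRegular_append_iff _ _ _).mp ((rs.take_append_drop k).symm ▸ hrs)).1
    · rw [List.length_take]
      omega

lemma smul_mem_smul_top_syzygy (hrs : IsWeaklyRegular R rs) (hn : rs.length < n) {s : R}
    (hs : ∀ r ∈ maximalIdeal R, r * s ∈ Ideal.ofList rs) (v : P.syzygy n) :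
    s • v ∈ (Ideal.ofList rs • ⊤ : Submodule R (P.syzygy n)) := by
  obtain ⟨n, rfl⟩ := Nat.exists_eq_succ_of_ne_zero hn.ne_bot
  have hsocle : maximalIdeal R • ⊤ ≤
      (Ideal.ofList rs • ⊤ : Submodule R (P.F n)).comap (LinearMap.lsmul R _ s) :=
    Submodule.smul_le.mpr fun r hr x _ ↦ by
      rw [Submodule.mem_comap, LinearMap.lsmul_apply, smul_smul, mul_comm]
      exact Submodule.smul_mem_smul (hs r hr) trivial
  exact P.comap_subtype_syzygy_smul_top_le
    (P.isWeaklyRegular_syzygy hrs (Nat.lt_succ_iff.mp hn)) (hsocle (P.minimal n v.2))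

end MinimalFreeResolution

section Depth

variable {R : Type u} [CommRing R] [IsLocalRing R]

lemma exists_isRegular_length_eq_localDepth (hR : localDepth R ≠ ⊤) :
    ∃ rs : List R, IsRegular R rs ∧ (rs.length : ℕ∞) = localDepth R := by
  let S := {rs : List R // (∀ r ∈ rs, r ∈ maximalIdeal R) ∧ IsRegular R rs}
  have : Nonempty S := ⟨[], by simp, IsRegular.nil R R⟩
  have hdepth : localDepth R = ⨆ rs : S, (rs.1.length : ℕ∞) := iSup_subtype'
  obtain ⟨⟨rs, _, hrs⟩, hlen⟩ := ENat.exists_eq_iSup_of_lt_top (hdepth ▸ hR.lt_top)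
  exact ⟨rs, hrs, hlen.trans hdepth.symm⟩

lemma ofList_le_maximalIdeal {rs : List R} (hrs : IsRegular R rs) :
    Ideal.ofList rs ≤ maximalIdeal R :=
  le_maximalIdeal fun h ↦ hrs.top_ne_smul (by simp [h])

lemma length_le_localDepth {rs : List R} (hrs : IsRegular R rs) :
    (rs.length : ℕ∞) ≤ localDepth R :=
  le_iSup₂_of_le (f := fun (rs : List R) _ ↦ (rs.length : ℕ∞)) rs
    ⟨fun _ hr ↦ ofList_le_maximalIdeal hrs (Ideal.subset_span hr), hrs⟩ le_rfl

lemma not_isSMulRegular_of_length_eq_localDepth {rs : List R} (hrs : IsRegular R rs)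
    (hlen : (rs.length : ℕ∞) = localDepth R) {y : R} (hy : y ∈ maximalIdeal R) :
    ¬ IsSMulRegular (R ⧸ Ideal.ofList rs) y := by
  intro hreg
  have hsucc : IsRegular R (rs ++ [y]) := by
    refine .of_isWeaklyRegular_of_mem_maximalIdeal R (fun r hr ↦ ?_) ?_
    · rcases List.mem_append.mp hr with hr | hr
      · exact ofList_le_maximalIdeal hrs (Ideal.subset_span hr)
      · exact List.mem_singleton.mp hr ▸ hy
    · rw [isWeaklyRegular_append_iff, isWeaklyRegular_singleton_iff, smul_eq_mul, Ideal.mul_top]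
      exact ⟨hrs.1, hreg⟩
  have := hlen ▸ length_le_localDepth hsucc
  rw [List.length_append] at this
  norm_cast at this
  simp at this

lemma exists_socle_of_length_eq_localDepth [IsNoetherianRing R] {rs : List R} (hrs : IsRegular R rs)
    (hlen : (rs.length : ℕ∞) = localDepth R) :
    ∃ s ∉ Ideal.ofList rs, ∀ r ∈ maximalIdeal R, r * s ∈ Ideal.ofList rs := by
  have hhom : ¬ Subsingleton ((R ⧸ maximalIdeal R) →ₗ[R] R ⧸ Ideal.ofList rs) := by
    rw [IsSMulRegular.subsingleton_linearMap_iff, Ideal.annihilator_quotient]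
    exact fun ⟨y, hy, hreg⟩ ↦ not_isSMulRegular_of_length_eq_localDepth hrs hlen hy hreg
  rw [not_subsingleton_iff_nontrivial] at hhom
  obtain ⟨f, hf⟩ := exists_ne (0 : (R ⧸ maximalIdeal R) →ₗ[R] R ⧸ Ideal.ofList rs)
  obtain ⟨s, hs⟩ := Ideal.Quotient.mk_surjective (f 1)
  refine ⟨s, fun h ↦ hf ?_, fun r hr ↦ ?_⟩
  · ext
    simpa [Ideal.Quotient.eq_zero_iff_mem.mpr h] using hs.symm
  · have h0 : r • (1 : R ⧸ maximalIdeal R) = 0 := by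
      simpa [Algebra.smul_def] using Ideal.Quotient.eq_zero_iff_mem.mpr hr
    rw [← Ideal.Quotient.eq_zero_iff_mem, map_mul, hs, ← Ideal.Quotient.algebraMap_eq,
      ← Algebra.smul_def, ← map_smul, h0, map_zero]

lemma exists_comp_eq_smul_id_of_socle {I : Ideal R} (hI : I ≤ maximalIdeal R) {s : R} (hs : s ∉ I)
    (hsocle : ∀ r ∈ maximalIdeal R, r * s ∈ I) :
    ∃ (ι : (R ⧸ maximalIdeal R) →ₗ[R] R ⧸ I) (π : (R ⧸ I) →ₗ[R] R ⧸ maximalIdeal R),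
      Function.Injective ι ∧ Function.Surjective π ∧ ι ∘ₗ π = s • LinearMap.id := by
  let ι := (maximalIdeal R).mapQ I (LinearMap.toSpanSingleton R R s) hsocle
  have hι0 : ι ≠ 0 := fun h0 ↦ hs <| by
    have h1 : Submodule.Quotient.mk ((1 : R) • s) = (0 : R ⧸ I) := congr($h0 1)
    rwa [one_smul, Submodule.Quotient.mk_eq_zero] at h1
  have : IsSimpleModule R (R ⧸ maximalIdeal R) :=
    isSimpleModule_iff_isCoatom.mpr (maximalIdeal.isMaximal R).out
  refine ⟨ι, Submodule.factor hI, ι.injective_of_ne_zero hι0, Submodule.factor_surjective hI, ?_⟩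
  ext
  exact congr(Submodule.Quotient.mk $(mul_comm 1 s))

end Depth

section Semidualizing

open scoped Pointwise

variable {R : Type u} [CommRing R]

lemma exists_comp_eq_of_subsingleton_ext {L : ModuleCat.{u} R} {S : ShortComplex (ModuleCat.{u} R)}
    (hS : S.ShortExact) (h₁ : Subsingleton (Ext L S.X₁ 1)) (g : L ⟶ S.X₃) :
    ∃ h : L ⟶ S.X₂, h ≫ S.g = g := by
  obtain ⟨x, hx⟩ := Ext.covariant_sequence_exact₃ L hS (Ext.mk₀ g) (zero_add 1)
    (Subsingleton.elim _ _)
  obtain ⟨h, rfl⟩ := (Ext.mk₀_bijective L S.X₂).2 x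
  exact ⟨h, (Ext.mk₀_bijective L S.X₃).1 (by rw [← hx, Ext.mk₀_comp_mk₀])⟩

lemma subsingleton_ext_X₃ {L : ModuleCat.{u} R} {S : ShortComplex (ModuleCat.{u} R)}
    (hS : S.ShortExact) {i : ℕ} (h₂ : Subsingleton (Ext L S.X₂ i))
    (h₁ : Subsingleton (Ext L S.X₁ (i + 1))) : Subsingleton (Ext L S.X₃ i) := by
  refine subsingleton_of_forall_eq 0 fun x ↦ ?_
  obtain ⟨x, rfl⟩ := Ext.covariant_sequence_exact₃ L hS x rfl (Subsingleton.elim _ _)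
  rw [Subsingleton.elim x 0, Ext.zero_comp]

lemma exists_eq_smul_of_range_le {L N : Type*} [AddCommGroup L] [Module R L] [AddCommGroup N]
    [Module R N] {y : R} (hy : IsSMulRegular N y) (g : L →ₗ[R] N)
    (hg : ∀ v, g v ∈ y • (⊤ : Submodule R N)) : ∃ h : L →ₗ[R] N, g = y • h := by
  let e := LinearEquiv.ofInjective (LinearMap.lsmul R N y) hy
  have hmem (v : L) : g v ∈ (LinearMap.lsmul R N y).range := by
    obtain ⟨w, -, hw⟩ := (Submodule.mem_smul_pointwise_iff_exists _ _ _).mp (hg v)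
    exact ⟨w, hw⟩
  refine ⟨e.symm.toLinearMap ∘ₗ g.codRestrict _ hmem, LinearMap.ext fun v ↦ ?_⟩
  exact congr(($(e.apply_symm_apply (g.codRestrict _ hmem v)) : N)).symm

/-- When `Ext^i(L, N)` vanishes for `i ≥ 1`, reduction modulo a regular sequence commutes with
`Hom(L, -)`. -/
lemma mem_ofList_smul_top_of_forall_apply_mem (L : ModuleCat.{u} R) (rs : List R)
    (N : ModuleCat.{u} R) (hN : IsWeaklyRegular N rs)
    (hext : ∀ i : ℕ, 1 ≤ i → Subsingleton (Ext L N i)) (g : L →ₗ[R] N)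
    (hg : ∀ v, g v ∈ (Ideal.ofList rs • ⊤ : Submodule R N)) :
    g ∈ (Ideal.ofList rs • ⊤ : Submodule R (L →ₗ[R] N)) := by
  induction rs generalizing N with
  | nil =>
    suffices g = 0 by simp [this]
    ext v
    simpa using hg v
  | cons y rs ih =>
    rw [isWeaklyRegular_cons_iff] at hN
    have hS := hN.1.smulShortComplex_shortExact
    let q : N →ₗ[R] QuotSMulTop y N := Submodule.mkQ _
    have hextQ (i : ℕ) (hi : 1 ≤ i) : Subsingleton (Ext L (.of R (QuotSMulTop y N)) i) :=
      subsingleton_ext_X₃ hS (hext i hi) (hext (i + 1) (by omega))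
    have hqg : q ∘ₗ g ∈ (Ideal.ofList rs • ⊤ : Submodule R (L →ₗ[R] QuotSMulTop y N)) :=
      ih (.of R (QuotSMulTop y N)) hN.2 hextQ _ fun v ↦ mkQ_mem_ofList_smul_top (hg v)
    have hqsurj : Function.Surjective (LinearMap.llcomp R L N (QuotSMulTop y N) q) := fun h ↦ by
      obtain ⟨f, hf⟩ := exists_comp_eq_of_subsingleton_ext hS (hext 1 le_rfl) (ModuleCat.ofHom h)
      exact ⟨f.hom, congr(ModuleCat.Hom.hom $hf)⟩
    obtain ⟨h, hh, hqh⟩ : q ∘ₗ g ∈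
        (Ideal.ofList rs • ⊤ : Submodule R (L →ₗ[R] N)).map (LinearMap.llcomp R L N _ q) := by
      rwa [Submodule.map_smul'', Submodule.map_top, LinearMap.range_eq_top.mpr hqsurj]
    obtain ⟨f, hf⟩ : ∃ f : L →ₗ[R] N, g - h = y • f := by
      refine exists_eq_smul_of_range_le hN.1 _ fun v ↦ ?_
      rw [← Submodule.Quotient.mk_eq_zero]
      exact (map_sub q (g v) (h v)).trans (sub_eq_zero.mpr congr($hqh.symm v))
    rw [← sub_add_cancel g h, hf, Ideal.ofList_cons_smul]
    exact add_mem (Submodule.mem_sup_left (Submodule.smul_mem_pointwise_smul f y ⊤ trivial))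
      (Submodule.mem_sup_right hh)

lemma IsSemidualizing.mem_of_forall_smul_mem_smul_top {L : Type u} [AddCommGroup L] [Module R L]
    (hL : IsSemidualizing R L) {rs : List R} (hrs : IsWeaklyRegular L rs) {s : R}
    (hs : ∀ v : L, s • v ∈ (Ideal.ofList rs • ⊤ : Submodule R L)) : s ∈ Ideal.ofList rs := by
  let e : R ≃ₗ[R] Module.End R L := .ofBijective (Algebra.linearMap R _) hL.bijective
  have hmem : e s ∈ (Ideal.ofList rs • ⊤ : Submodule R (Module.End R L)) :=
    mem_ofList_smul_top_of_forall_apply_mem (.of R L) rs (.of R L) hrs hL.ext_eq_zero _ hs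
  simpa using Submodule.smul_top_le_comap_smul_top _ e.symm.toLinearMap hmem

end Semidualizing

section InjectiveDimension

open scoped Pointwise

variable {R : Type u} [CommRing R]

lemma smul_ext_eq_zero_of_mem_annihilator_source {A N : ModuleCat.{u} R} {r : R}
    (hr : r ∈ Module.annihilator R A) {i : ℕ} (x : Ext A N i) : r • x = 0 := by
  have h0 : r • 𝟙 A = 0 := by
    ext a
    exact Module.mem_annihilator.mp hr a
  rw [← Ext.mk₀_id_comp x, ← Ext.smul_comp, ← Ext.mk₀_smul, h0, Ext.mk₀_zero, Ext.zero_comp]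

lemma smul_ext_eq_zero_of_mem_annihilator_target {A N : ModuleCat.{u} R} {r : R}
    (hr : r ∈ Module.annihilator R N) {i : ℕ} (x : Ext A N i) : r • x = 0 := by
  have h0 : r • 𝟙 N = 0 := by
    ext a
    exact Module.mem_annihilator.mp hr a
  rw [Ext.smul_eq_comp_mk₀, h0, Ext.mk₀_zero, Ext.comp_zero]

lemma smul_ext_eq_zero_of_forall_smul_mem_smul_top (A : ModuleCat.{u} R) (rs : List R)
    (hA : ∀ r ∈ rs, r ∈ Module.annihilator R A) (N : ModuleCat.{u} R) (hN : IsWeaklyRegular N rs)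
    {s : R} (hs : ∀ v : N, s • v ∈ (Ideal.ofList rs • ⊤ : Submodule R N))
    (x : Ext A N rs.length) : s • x = 0 := by
  induction rs generalizing N with
  | nil =>
    refine smul_ext_eq_zero_of_mem_annihilator_target (Module.mem_annihilator.mpr fun v ↦ ?_) x
    simpa only [Ideal.ofList_nil, Submodule.bot_smul, Submodule.mem_bot] using hs v
  | cons y rs ih =>
    rw [isWeaklyRegular_cons_iff] at hN
    have hS := hN.1.smulShortComplex_shortExact
    have hyx : x.comp (Ext.mk₀ (N.smulShortComplex y).f) (add_zero _) = 0 := by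
      rw [ModuleCat.smulShortComplex_f_eq_smul_id]
      exact (Ext.smul_eq_comp_mk₀ x y).symm.trans
        (smul_ext_eq_zero_of_mem_annihilator_source (hA y List.mem_cons_self) x)
    obtain ⟨z, rfl⟩ := Ext.covariant_sequence_exact₁ A hS x hyx rfl
    have hsQ (v : QuotSMulTop y N) :
        s • v ∈ (Ideal.ofList rs • ⊤ : Submodule R (QuotSMulTop y N)) := by
      obtain ⟨v, rfl⟩ := Submodule.mkQ_surjective _ v
      exact mkQ_mem_ofList_smul_top (hs v)
    have hz : s • z = 0 :=
      ih (fun r hr ↦ hA r (List.mem_cons_of_mem y hr)) (.of R (QuotSMulTop y N)) hN.2 hsQ z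
    exact (Ext.smul_comp z hS.extClass rfl s).symm.trans (by rw [hz]; exact Ext.zero_comp ..)

lemma exists_mk₀_comp_eq_of_injective {A B : Type u} [AddCommGroup A] [Module R A]
    [AddCommGroup B] [Module R B] {L : ModuleCat.{u} R} {f : A →ₗ[R] B}
    (hf : Function.Injective f) {i : ℕ}
    (h : Subsingleton (Ext (.of R (B ⧸ f.range)) L (i + 1))) (x : Ext (.of R A) L i) :
    ∃ z : Ext (.of R B) L i, (Ext.mk₀ (ModuleCat.ofHom f)).comp z (zero_add i) = x := by
  have hfg := LinearMap.exact_map_mkQ_range f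
  have hS := ModuleCat.shortComplex_shortExact
    (ModuleCat.shortComplexOfCompEqZero f _ hfg.linearMap_comp_eq_zero) hfg hf
    (Submodule.mkQ_surjective _)
  exact Ext.contravariant_sequence_exact₁ hS L x (add_comm 1 i) (h.elim _ _)

lemma eq_zero_of_mk₀_comp_eq_zero_of_surjective {A B : Type u} [AddCommGroup A] [Module R A]
    [AddCommGroup B] [Module R B] {L : ModuleCat.{u} R} {g : B →ₗ[R] A}
    (hg : Function.Surjective g) {i : ℕ}
    (h : ∀ j < i, Subsingleton (Ext (.of R g.ker) L j)) (x : Ext (.of R A) L i)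
    (hx : (Ext.mk₀ (ModuleCat.ofHom g)).comp x (zero_add i) = 0) : x = 0 := by
  have hS := LinearMap.shortExact_shortComplexKer hg
  cases i with
  | zero =>
    have := hS.epi_g
    exact Ext.precomp_mk₀_injective_of_epi L (ModuleCat.ofHom g) (hx.trans (map_zero _).symm)
  | succ i =>
    obtain ⟨z, rfl⟩ := Ext.contravariant_sequence_exact₃ hS L x hx (add_comm 1 i)
    rw [(h i i.lt_succ_self).elim z 0, Ext.comp_zero]

/-- Writing `x = f^* z`, one has `g^* x = s • z = 0`, and `g^*` is injective on `Ext^i`. -/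
lemma subsingleton_ext_of_comp_eq_smul_id {A B : Type u} [AddCommGroup A] [Module R A]
    [AddCommGroup B] [Module R B] {L : ModuleCat.{u} R} {f : A →ₗ[R] B} {g : B →ₗ[R] A}
    (hf : Function.Injective f) (hg : Function.Surjective g) {s : R}
    (hfg : f ∘ₗ g = s • LinearMap.id) {i : ℕ} (hs : ∀ z : Ext (.of R B) L i, s • z = 0)
    (hcoker : Subsingleton (Ext (.of R (B ⧸ f.range)) L (i + 1)))
    (hker : ∀ j < i, Subsingleton (Ext (.of R g.ker) L j)) :
    Subsingleton (Ext (.of R A) L i) := by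
  refine subsingleton_of_forall_eq 0 fun x ↦ ?_
  obtain ⟨z, rfl⟩ := exists_mk₀_comp_eq_of_injective hf hcoker x
  refine eq_zero_of_mk₀_comp_eq_zero_of_surjective hg hker _ ?_
  have hcomp : ModuleCat.ofHom g ≫ ModuleCat.ofHom f = s • 𝟙 (.of R B) := by
    rw [← ModuleCat.ofHom_comp, hfg]
    rfl
  rw [Ext.mk₀_comp_mk₀_assoc, hcomp, Ext.mk₀_smul, Ext.smul_comp, Ext.mk₀_id_comp, hs]

/-- The vanishing of `Ext^i(-, L)` on all finitely generated modules, the property propagated by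
downward induction on `i` when `L` has finite injective dimension. -/
def ExtVanishesOnFinite (L : ModuleCat.{u} R) (i : ℕ) : Prop :=
  ∀ (C : Type u) [AddCommGroup C] [Module R C] [Module.Finite R C],
    Subsingleton (Ext (.of R C) L i)

variable [IsNoetherianRing R] {L : ModuleCat.{u} R}

lemma subsingleton_ext_of_lt_length {rs : List R} [Module.Finite R L] (hrs : IsRegular L rs)
    {C : Type u} [AddCommGroup C] [Module R C] [Module.Finite R C]
    (hC : Ideal.ofList rs ≤ Module.annihilator R C) {i : ℕ} (hi : i < rs.length) :
    Subsingleton (Ext (.of R C) L i) :=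
  ModuleCat.subsingleton_ext_of_exists_isRegular (Ideal.ofList rs) (.of R C)
    (Module.support_eq_zeroLocus.trans_subset (PrimeSpectrum.zeroLocus_anti_mono hC)) L
    hrs.top_ne_smul.symm.lt_top rs (fun _ hr ↦ Ideal.subset_span hr) hrs i hi

variable [IsLocalRing R]

lemma subsingleton_ext_of_subsingleton_ext_quotSMulTop [Module.Finite R L] {C : Type u}
    [AddCommGroup C] [Module R C] [Module.Finite R C] {y : R} (hy : y ∈ maximalIdeal R)
    (hreg : IsSMulRegular C y) {i : ℕ}
    (h : Subsingleton (Ext (.of R (QuotSMulTop y C)) L (i + 1))) :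
    Subsingleton (Ext (.of R C) L i) := by
  have hS := IsSMulRegular.smulShortComplex_shortExact (M := .of R C) hreg
  have hsmul (x : Ext (.of R C) L i) : ∃ z : Ext (.of R C) L i, y • z = x := by
    obtain ⟨z, hz⟩ : ∃ z, (Ext.mk₀ (y • 𝟙 (ModuleCat.of R C))).comp z (zero_add i) = x :=
      Ext.contravariant_sequence_exact₁ hS L x (add_comm 1 i) (h.elim _ _)
    exact ⟨z, by rw [← hz, Ext.mk₀_smul, Ext.smul_comp, Ext.mk₀_id_comp]⟩
  by_contra! hnt
  refine Submodule.top_ne_pointwise_smul_of_mem_jacobson_annihilator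
    (maximalIdeal_le_jacobson (Module.annihilator R (Ext (.of R C) L i)) hy) ?_
  refine (eq_top_iff.mpr fun x _ ↦ ?_).symm
  obtain ⟨z, rfl⟩ := hsmul x
  exact Submodule.smul_mem_pointwise_smul z y ⊤ trivial

lemma ExtVanishesOnFinite.of_succ [Module.Finite R L] {i : ℕ} (h : ExtVanishesOnFinite L (i + 1))
    (hk : Subsingleton (Ext (.of R (R ⧸ maximalIdeal R)) L i)) : ExtVanishesOnFinite L i := by
  intro C _ _ hC
  induction hC using IsNoetherianRing.induction_on_isQuotientEquivQuotientPrime R with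
  | subsingleton N =>
    refine subsingleton_of_forall_eq 0 fun x ↦ ?_
    rw [← Ext.mk₀_id_comp x, (ModuleCat.isZero_of_subsingleton (.of R N)).eq_of_src (𝟙 _) 0,
      Ext.mk₀_zero, Ext.zero_comp]
  | quotient N p e =>
    by_cases hp : p.1 = maximalIdeal R
    · let e' : ModuleCat.of R N ≅ .of R (R ⧸ maximalIdeal R) :=
        (e.trans (Submodule.quotEquivOfEq _ _ hp)).toModuleIso
      refine subsingleton_of_forall_eq 0 fun x ↦ ?_
      rw [← Ext.mk₀_id_comp x, ← e'.hom_inv_id, ← Ext.mk₀_comp_mk₀_assoc,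
        hk.elim ((Ext.mk₀ e'.inv).comp x _) 0, Ext.comp_zero]
    · obtain ⟨y, hy, hyp⟩ := SetLike.exists_of_lt ((le_maximalIdeal p.2.ne_top).lt_of_ne hp)
      have hreg : IsSMulRegular N y := by
        rw [e.isSMulRegular_congr, isSMulRegular_quotient_iff_mem_of_smul_mem]
        exact fun r hr ↦ (p.2.mem_or_mem hr).resolve_left hyp
      exact subsingleton_ext_of_subsingleton_ext_quotSMulTop hy hreg (h _)
  | exact N₁ N₂ N₃ f g hf hg hfg h₁ h₃ =>
    have hS := ModuleCat.shortComplex_shortExact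
      (ModuleCat.shortComplexOfCompEqZero f g hfg.linearMap_comp_eq_zero) hfg hf hg
    refine subsingleton_of_forall_eq 0 fun x ↦ ?_
    obtain ⟨z, rfl⟩ := Ext.contravariant_sequence_exact₂ hS L x (h₁.elim _ _)
    rw [h₃.elim z 0, Ext.comp_zero]

lemma subsingleton_of_injectiveDimension_lt_top [Module.Finite R L]
    (hL : injectiveDimension L < ⊤)
    (hk : ∀ i, ExtVanishesOnFinite L (i + 1) →
      Subsingleton (Ext (.of R (R ⧸ maximalIdeal R)) L i)) : Subsingleton L := by
  obtain ⟨t, _⟩ := (injectiveDimension_ne_top_iff _).mp hL.ne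
  have h₀ : ExtVanishesOnFinite L 0 :=
    Nat.decreasingInduction (motive := fun i _ ↦ ExtVanishesOnFinite L i)
      (fun i _ h ↦ h.of_succ (hk i h))
      (fun C _ _ _ ↦ HasInjectiveDimensionLT.subsingleton L (t + 1) _ le_rfl (.of R C))
      (t + 1).zero_le
  have := h₀ R
  exact (Ext.addEquiv₀.toEquiv.trans
    (ModuleCat.homEquiv.trans (LinearMap.ringLmapEquivSelf R R L).toEquiv)).subsingleton_congr.mp
    this

lemma subsingleton_ext_quotient_ofList_of_length_lt {rs : List R} (hrs : IsRegular R rs) {i : ℕ}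
    (hi : rs.length < i) : Subsingleton (Ext (.of R (R ⧸ Ideal.ofList rs)) L i) := by
  have hpd : projectiveDimension (.of R (R ⧸ Ideal.ofList rs) : ModuleCat.{u} R) = rs.length :=
    (projectiveDimension_eq_of_iso (Shrink.linearEquiv R _).symm.toModuleIso).trans
      (ModuleCat.projectiveDimension_quotient_eq_length rs hrs)
  have := (projectiveDimension_le_iff _ _).mp hpd.le
  exact HasProjectiveDimensionLT.subsingleton _ (rs.length + 1) i hi L

lemma subsingleton_ext_residueField {rs : List R} [Module.Finite R L] (hrs : IsRegular R rs)
    (hL : IsRegular L rs) {s : R} (hs : s ∉ Ideal.ofList rs)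
    (hsocle : ∀ r ∈ maximalIdeal R, r * s ∈ Ideal.ofList rs)
    (hsL : ∀ v : L, s • v ∈ (Ideal.ofList rs • ⊤ : Submodule R L)) {i : ℕ}
    (h : ExtVanishesOnFinite L (i + 1)) :
    Subsingleton (Ext (.of R (R ⧸ maximalIdeal R)) L i) := by
  obtain ⟨ι, π, hι, hπ, hιπ⟩ :=
    exists_comp_eq_smul_id_of_socle (ofList_le_maximalIdeal hrs) hs hsocle
  rcases lt_trichotomy i rs.length with hi | rfl | hi
  · exact subsingleton_ext_of_lt_length hL
      ((ofList_le_maximalIdeal hrs).trans Ideal.annihilator_quotient.ge) hi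
  · have hann : Ideal.ofList rs ≤ Module.annihilator R (R ⧸ Ideal.ofList rs) :=
      Ideal.annihilator_quotient.ge
    refine subsingleton_ext_of_comp_eq_smul_id hι hπ hιπ
      (smul_ext_eq_zero_of_forall_smul_mem_smul_top _ rs
        (fun r hr ↦ hann (Ideal.subset_span hr)) L hL.1 hsL) (h _) fun j hj ↦ ?_
    exact subsingleton_ext_of_lt_length hL
      (hann.trans (LinearMap.annihilator_le_of_injective _ π.ker.injective_subtype)) hj
  · have := subsingleton_ext_quotient_ofList_of_length_lt (L := L) hrs hi
    refine subsingleton_of_forall_eq 0 fun x ↦ ?_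
    obtain ⟨z, rfl⟩ := exists_mk₀_comp_eq_of_injective hι (h _) x
    rw [Subsingleton.elim z 0, Ext.comp_zero]

lemma mem_of_forall_smul_mem_smul_top_of_injectiveDimension_lt_top {L : Type u} [AddCommGroup L]
    [Module R L] [Module.Finite R L] [Nontrivial L]
    (hid : injectiveDimension (ModuleCat.of R L) < ⊤)
    {rs : List R} (hrs : IsRegular R rs) (hL : IsWeaklyRegular L rs) {s : R}
    (hsocle : ∀ r ∈ maximalIdeal R, r * s ∈ Ideal.ofList rs)
    (hs : ∀ v : L, s • v ∈ (Ideal.ofList rs • ⊤ : Submodule R L)) : s ∈ Ideal.ofList rs := by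
  by_contra hsI
  have hLreg : IsRegular L rs := .of_isWeaklyRegular_of_mem_maximalIdeal L
    (fun _ hr ↦ ofList_le_maximalIdeal hrs (Ideal.subset_span hr)) hL
  exact not_subsingleton L <| subsingleton_of_injectiveDimension_lt_top (L := .of R L) hid
    fun _ ↦ subsingleton_ext_residueField hrs hLreg hsI hsocle hs

end InjectiveDimension

theorem corollary3p4_general {R : Type u} [CommRing R] [IsLocalRing R] [IsNoetherianRing R]
    {M : Type u} [AddCommGroup M] [Module R M] (P : MinimalFreeResolution R M) {n : ℕ}
    (hn : localDepth R < n) {L K : Type u} [AddCommGroup L] [Module R L] [AddCommGroup K]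
    [Module R K] (e : P.syzygy n ≃ₗ[R] L × K) [Nontrivial L] :
    ¬ IsSemidualizing R L ∧
      ¬ Module.Free R L ∧
      ¬ injectiveDimension (ModuleCat.of R L) < ⊤ := by
  obtain ⟨rs, hrs, hlen⟩ := exists_isRegular_length_eq_localDepth hn.ne_top
  obtain ⟨s, hs, hsocle⟩ := exists_socle_of_length_eq_localDepth hrs hlen
  have hn : rs.length < n := by exact_mod_cast hlen ▸ hn
  let p : P.syzygy n →ₗ[R] L := LinearMap.fst R L K ∘ₗ e.toLinearMap
  let i : L →ₗ[R] P.syzygy n := e.symm.toLinearMap ∘ₗ LinearMap.inl R L K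
  have hpi : Function.LeftInverse p i := fun v ↦ by simp [p, i]
  have hfin : Module.Finite R L :=
    have := P.finite n
    .of_surjective (p ∘ₗ (P.augDiff n).rangeRestrict)
      (hpi.surjective.comp (P.augDiff n).surjective_rangeRestrict)
  have hL : IsWeaklyRegular L rs :=
    isWeaklyRegular_of_leftInverse (P.isWeaklyRegular_syzygy hrs.1 hn.le) hpi
  have hsL (v : L) : s • v ∈ (Ideal.ofList rs • ⊤ : Submodule R L) := by
    rw [← hpi v, ← map_smul]
    exact Submodule.smul_top_le_comap_smul_top _ p
      (P.smul_mem_smul_top_syzygy hrs.1 hn hsocle (i v))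
  exact ⟨fun hsd ↦ hs (hsd.mem_of_forall_smul_mem_smul_top hL hsL),
    fun _ ↦ hs (mem_of_forall_smul_mem_smul_top_of_free hsL),
    fun hid ↦ hs <|
      mem_of_forall_smul_mem_smul_top_of_injectiveDimension_lt_top hid hrs hL hsocle hsL⟩

theorem corollary3p4 {R : Type u} [CommRing R] [IsLocalRing R]
    (hR : IsCohenMacaulayLocalRing R) (d : ℕ) (hd : ringKrullDim R = d)
    {M : Type u} [AddCommGroup M] [Module R M] [Module.Finite R M]
    (P : MinimalFreeResolution R M) (n : ℕ) (hn : d + 1 ≤ n)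
    {L K : Type u} [AddCommGroup L] [Module R L] [AddCommGroup K] [Module R K]
    (e : P.syzygy n ≃ₗ[R] L × K) (hL : Nontrivial L) :
    ¬ IsSemidualizing R L ∧
      ¬ Module.Free R L ∧
      ¬ CategoryTheory.injectiveDimension (ModuleCat.of R L) < ⊤ := by
  have := hR.noetherian
  have hdepth : localDepth R = d := WithBot.coe_injective (hR.depth_eq_dim.trans hd)
  exact corollary3p4_general P (hdepth ▸ mod_cast hn) e
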